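/- A family $Q_0,\dots,Q_{q-1}$ of pairwise disjoint subsets of $\mathbb Z_v$ is a \emph{difference system of sets} (DSS) of index $\rho$ if the multiset $\{a-b : a\in Q_i,\ b\in Q_j,\ i\ne j\}$ contains every nonzero $d\in\mathbb Z_v$ at least $\rho$ times. It is \emph{perfect} if every nonzero $d$ occurs exactly $\rho$ times, and \emph{regular} if all $Q_i$ have the same size $m$; it is then denoted DSS$(v,m,q,\rho)$. Its \emph{redundancy} is $|Q_0\cup\dots\cup Q_{q-1}|$, and it is \emph{optimal} if its redundancy is the least among all DSSs of index $\rho$ consisting of $q$ sets over $\mathbb Z_v$. For a set (payload code) $D$ of words over $\mathbb Z_q$ indexed by the positions in $\{0,\dots,v-1\}\setminus\bigcup_i Q_i$ (the free positions), let $\mathcal C(Q,D)$ be the $q$-ary code of length $v$ of all words that carry the symbol $i$ in every position of $Q_i$ and whose restriction to the free positions lies in $D$. A code $C$ of length $v$ is \emph{comma-free (self-synchronizing) with index} $\rho$ if for all $x,y,z\in C$ and $1\le i\le v-1$ the Hamming distance between $z$ and the splice $(x_{v-i},\dots,x_{v-1},y_0,\dots,y_{v-i-1})$ is at least $\rho$.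 **Theorem.** Let $n$ be a natural number such that $p=12n^2+1$ is prime. Then there exists a perfect regular DSS$(12n^2+1,2n^2,3,2n^2)$. More precisely, let $\alpha$ be any primitive element of $\mathbb F_p=\mathbb Z_p$, let $C_i^6=\{\alpha^{i+6t} : 0\le t\le 2n^2-1\}$, and put $Q=(C_0^6,C_2^6,C_4^6)$. Then: 1. $Q$ is a perfect regular DSS$(12n^2+1,2n^2,3,2n^2)$, and it is optimal, with redundancy $6n^2$. 2. For every payload code $D$, the ternary code $\mathcal C(Q,D)$ is comma-free with index $2n^2$. If $D$ is a linear code over $\mathbb F_3$, then $\mathcal C(Q,D)$ is a coset of a ternary linear code of length $p$ and dimension $\dim D$. 3. With unrestricted payload (all ternary words in the free positions), $\mathcal C(Q,D)$ has $3^{6n^2+1}$ codewords, which is the largest number obtained in this way from any DSS of index $2n^2$ consisting of three sets over $\mathbb Z_p$. -/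

import Mathlib

/-- The multiset of outer differences `a - b` with `a ∈ Q i`, `b ∈ Q j`, `i ≠ j`, for a family
of subsets of `ℤ/v`. -/
def outerDifferences {v q : ℕ} (Q : Fin q → Finset (ZMod v)) : Multiset (ZMod v) :=
  ∑ ij ∈ (Finset.univ : Finset (Fin q)).offDiag,
    (Q ij.1 ×ˢ Q ij.2).val.map (fun ab => ab.1 - ab.2)

/-- A difference system of sets of index `ρ`: pairwise disjoint subsets of `ℤ/v` such that every
nonzero residue is an outer difference at least `ρ` times. -/
structure IsDSS {v q : ℕ} (Q : Fin q → Finset (ZMod v)) (ρ : ℕ) : Prop where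
  disjoint : ∀ i j, i ≠ j → Disjoint (Q i) (Q j)
  le_count : ∀ d : ZMod v, d ≠ 0 → ρ ≤ (outerDifferences Q).count d

/-- A perfect regular `DSS(v, m, q, ρ)`: a difference system of sets of index `ρ` consisting of
`q` sets of size `m`, in which every nonzero residue is an outer difference exactly `ρ` times. -/
structure IsPerfectRegularDSS (v m q ρ : ℕ) (Q : Fin q → Finset (ZMod v)) : Prop where
  isDSS : IsDSS Q ρ
  regular : ∀ i, (Q i).card = m
  perfect : ∀ d : ZMod v, d ≠ 0 → (outerDifferences Q).count d = ρ

/-- The number of elements of the union of the sets of the family. -/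
def dssRedundancy {v q : ℕ} (Q : Fin q → Finset (ZMod v)) : ℕ :=
  (Finset.univ.biUnion Q).card

/-- An optimal difference system of sets: its redundancy is least among all difference systems
of `q` sets over `ℤ/v` of index `ρ`. -/
def IsOptimalDSS {v q : ℕ} (Q : Fin q → Finset (ZMod v)) (ρ : ℕ) : Prop :=
  IsDSS Q ρ ∧ ∀ P : Fin q → Finset (ZMod v), IsDSS P ρ → dssRedundancy Q ≤ dssRedundancy P

/-- The cyclotomic class `C_i^f = {α ^ (i + t f) | 0 ≤ t ≤ m - 1}` in `ℤ/p`, where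
`p = f m + 1`. -/
def cyclotomicClass {p : ℕ} (α : (ZMod p)ˣ) (f i : ℕ) : Finset (ZMod p) :=
  (Finset.range ((p - 1) / f)).image (fun t => ((α ^ (i + t * f) : (ZMod p)ˣ) : ZMod p))

/-- The splice `(x_{v-i}, …, x_{v-1}, y_0, …, y_{v-i-1})` of two words of length `v`, where
`1 ≤ i ≤ v - 1`. -/
def splice {A : Type*} {v : ℕ} (x y : Fin v → A) (i : ℕ) : Fin v → A := fun k =>
  if h : (k : ℕ) < i then x ⟨v - i + k, by have := k.isLt; omega⟩
  else y ⟨k - i, by have := k.isLt; omega⟩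

/-- A block code of length `v` is comma-free with index `ρ` if every codeword has Hamming distance
at least `ρ` from every splice of two codewords. -/
def IsCommaFree {A : Type*} [DecidableEq A] {v : ℕ} (C : Set (Fin v → A)) (ρ : ℕ) : Prop :=
  ∀ x ∈ C, ∀ y ∈ C, ∀ z ∈ C, ∀ i : ℕ, 1 ≤ i → i < v → ρ ≤ hammingDist z (splice x y i)

/-- The positions `0 ≤ k < v` whose residue lies in none of the sets `Q i`. -/
abbrev FreePosition {v q : ℕ} (Q : Fin q → Finset (ZMod v)) : Type :=
  {k : Fin v // ∀ i, ((k : ℕ) : ZMod v) ∉ Q i}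

/-- The `q`-ary code of length `v` obtained from the family `Q` and the payload code `D`: the
positions in `Q i` carry the symbol `i`, and the word in the free positions belongs to `D`. -/
def markerCode {v q : ℕ} (Q : Fin q → Finset (ZMod v)) (D : Set (FreePosition Q → ZMod q)) :
    Set (Fin v → ZMod q) :=
  {w | (∀ (i : Fin q) (k : Fin v), ((k : ℕ) : ZMod v) ∈ Q i → w k = ((i : ℕ) : ZMod q)) ∧
    (fun k : FreePosition Q => w k.1) ∈ D}

/-! Let `χ` be the quadratic and `ψ` a cubic character of `F_p`. The three classes partition the
nonzero squares according to the value of `ψ`, so `d` occurs as an outer difference once for each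
`y` such that `y` and `y + d` are squares with `ψ y ≠ ψ (y + d)`. The ratio `r = (y + d) / y` turns
this into counting square noncubes `r` with `χ (r - 1) = χ d` (`card_filter_quadraticChar_eq`). The
count is independent of `d` exactly when `χ (r - 1)` sums to zero over the square noncubes, and for
this it suffices that `N`, the sum of `χ (1 - u)` over nonzero cubes `u`, equals `-1`.

The Jacobi sum `J(ψ, χ)` lies in `ℤ[ω]`, with norm `p` and trace `3 N + 1`; hence `4 p = (3 N + 1)²
+ 3 B²` (`four_mul_card_eq`). As `N` is odd, this halves to a representation of `p` by `x² + 3 y²`.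
Such a representation is unique up to signs, and `p = 1 + 3 (2 n)²`, so `(3 N + 1) / 2 = ± 1`, and
integrality leaves `N = -1`.

Optimality is equality in Levenshtein's bound. Self-synchronization holds because each outer
difference equal to the shift is a position where two markers disagree. -/

/-- A prime of the form `1 + 3 m²` is represented by `x² + 3 y²` with `x = ± 1` only. -/
theorem sq_eq_one_of_sq_add_three_mul_sq {p : ℕ} (hp : p.Prime) {x y m : ℤ}
    (hxy : x ^ 2 + 3 * y ^ 2 = p) (hm : 1 + 3 * m ^ 2 = p) : x ^ 2 = 1 := by
  have hp' : Prime (p : ℤ) := Nat.prime_iff_prime_int.mp hp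
  have hpos : (0 : ℤ) < p := by exact_mod_cast hp.pos
  have key : ∀ x : ℤ, x ^ 2 + 3 * y ^ 2 = p → (p : ℤ) ∣ x * m - y → x ^ 2 = 1 := by
    rintro x hx ⟨t, ht⟩
    -- Brahmagupta's identity for the product of the two representations. A nonzero multiple of `p`
    -- as second component would make the left side at least `3 p²`.
    have h1 : (x + 3 * y * m) ^ 2 + 3 * (x * m - y) ^ 2 = (p : ℤ) ^ 2 := by
      linear_combination (1 + 3 * m ^ 2) * hx + (p : ℤ) * hm
    rw [ht] at h1
    have ht0 : t = 0 := by
      by_contra h0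
      have : 0 < t ^ 2 := by positivity
      nlinarith [sq_nonneg (x + 3 * y * m), mul_pos hpos hpos]
    have hy : y = x * m := by rw [ht0] at ht; linarith
    have h2 : x ^ 2 * p = p := by
      rw [← hm]; rw [hy] at hx; linear_combination hx - hm
    exact mul_right_cancel₀ hpos.ne' (h2.trans (one_mul _).symm)
  have hdvd : (p : ℤ) ∣ (x * m - y) * (x * m + y) :=
    ⟨m ^ 2 - y ^ 2, by linear_combination m ^ 2 * hxy - y ^ 2 * hm⟩
  rcases hp'.dvd_or_dvd hdvd with h | h
  · exact key x hxy h
  · have := key (-x) (by simpa using hxy) (by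
      rw [show -x * m - y = -(x * m + y) by ring]; exact (dvd_neg).mpr h)
    simpa using this

/-! ### Jacobi sum of a cubic and the quadratic character -/

/-- From `1 + z + z² = 0` for a nontrivial cube root of unity `z`. Thus `1 + ψ + ψ⁻¹` is three times
the indicator of the nonzero cubes, up to a correction at zero. -/
theorem MulChar.apply_eq_one_or_add_inv_apply {F : Type*} [Field F] {ψ : MulChar F ℂ}
    (h3 : ψ ^ 3 = 1) {u : F} (hu : u ≠ 0) :
    ψ u = 1 ∧ ψ⁻¹ u = 1 ∨ ψ u ≠ 1 ∧ ψ u + ψ⁻¹ u = -1 := by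
  have h : ψ u ^ 3 = 1 := by
    rw [← MulChar.pow_apply' ψ (by norm_num), h3, MulChar.one_apply hu.isUnit]
  have hinv : ψ⁻¹ u = ψ u ^ 2 := by
    rw [← MulChar.pow_apply' ψ (by norm_num)]
    congr 1
    exact inv_eq_of_mul_eq_one_right (by rw [← h3, pow_succ' ψ 2])
  rw [hinv]
  by_cases h1 : ψ u = 1
  · simp [h1]
  · refine Or.inr ⟨h1, ?_⟩
    have : (ψ u - 1) * (ψ u + ψ u ^ 2 + 1) = 0 := by linear_combination h
    rcases mul_eq_zero.mp this with h | h
    · exact absurd (sub_eq_zero.mp h) h1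
    · linear_combination h

section CubicCharacter

variable {F : Type*} [Field F] [Fintype F] [DecidableEq F] {ψ : MulChar F ℂ}

/-- The sum of the quadratic character over `1 - u`, where `u` ranges over the cubes. -/
noncomputable def cubicQuadraticSum (ψ : MulChar F ℂ) : ℤ :=
  ∑ u with ψ u = 1, quadraticChar F (1 - u)

theorem sum_quadraticChar_one_sub (hF : ringChar F ≠ 2) :
    ∑ u : F, quadraticChar F (1 - u) = 0 :=
  (Equiv.sum_comp (Equiv.subLeft (1 : F)) (fun u => quadraticChar F u)).trans
    (quadraticChar_sum_zero hF)

theorem exists_int_jacobiSum_quadraticChar (h3 : ψ ^ 3 = 1) {ω : ℂ} (hω : IsPrimitiveRoot ω 3) :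
    ∃ A B : ℤ, jacobiSum ψ ((quadraticChar F).ringHomComp (Int.castRingHom ℂ)) = A + B * ω := by
  have hω2 : ω ^ 2 = -1 - ω := by
    have := hω.geom_sum_eq_zero (by norm_num)
    simp only [Finset.sum_range_succ, Finset.sum_range_zero] at this
    linear_combination this
  have h : ∀ u : F, ∃ a b : ℤ, ψ u = a + b * ω := by
    intro u
    by_cases hu : u = 0
    · exact ⟨0, 0, by simp [hu, MulChar.map_zero]⟩
    · obtain ⟨k, hk, h⟩ := MulChar.exists_apply_eq_pow h3 hω hu
      rw [h]
      interval_cases k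
      · exact ⟨1, 0, by simp⟩
      · exact ⟨0, 1, by simp⟩
      · exact ⟨-1, -1, by rw [hω2]; push_cast; ring⟩
  choose a b h using h
  refine ⟨∑ u, a u * quadraticChar F (1 - u), ∑ u, b u * quadraticChar F (1 - u), ?_⟩
  push_cast
  rw [jacobiSum, Finset.sum_mul, ← Finset.sum_add_distrib]
  refine Finset.sum_congr rfl fun u _ => ?_
  simp only [MulChar.ringHomComp_apply, h, eq_intCast]
  ring

/-- Expand `ψ + ψ⁻¹ = 3 · [ψ u = 1] + [u = 0] - 1`; the constant term contributes nothing because `χ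
(1 - u)` sums to zero. -/
theorem jacobiSum_add_inv_quadraticChar (hF : ringChar F ≠ 2) (h3 : ψ ^ 3 = 1) :
    jacobiSum ψ ((quadraticChar F).ringHomComp (Int.castRingHom ℂ)) +
      jacobiSum ψ⁻¹ ((quadraticChar F).ringHomComp (Int.castRingHom ℂ)) =
    3 * cubicQuadraticSum ψ + 1 := by
  have h0 : ∑ u : F, ((quadraticChar F (1 - u) : ℤ) : ℂ) = 0 := by
    exact_mod_cast sum_quadraticChar_one_sub hF
  have h1 : ∑ u : F, (if u = 0 then ((quadraticChar F (1 - u) : ℤ) : ℂ) else 0) = 1 := by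
    simp
  have key : ∀ u : F, ψ u * ((quadraticChar F (1 - u) : ℤ) : ℂ) +
      ψ⁻¹ u * ((quadraticChar F (1 - u) : ℤ) : ℂ) =
      3 * (if ψ u = 1 then ((quadraticChar F (1 - u) : ℤ) : ℂ) else 0) +
      (if u = 0 then ((quadraticChar F (1 - u) : ℤ) : ℂ) else 0) -
      ((quadraticChar F (1 - u) : ℤ) : ℂ) := by
    intro u
    by_cases hu : u = 0
    · simp [hu, MulChar.map_zero]
    · rcases MulChar.apply_eq_one_or_add_inv_apply h3 hu with ⟨h, h'⟩ | ⟨h, h'⟩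
      · simp only [h, h', hu, if_true, if_false]; ring
      · simp only [h, hu, if_false]
        linear_combination ((quadraticChar F (1 - u) : ℤ) : ℂ) * h'
  have hsum := Finset.sum_congr (rfl : (Finset.univ : Finset F) = _) fun u _ => key u
  rw [Finset.sum_add_distrib, Finset.sum_sub_distrib, Finset.sum_add_distrib, h0, h1,
    ← Finset.mul_sum, ← Finset.sum_filter, sub_zero] at hsum
  rw [jacobiSum, jacobiSum, cubicQuadraticSum, Int.cast_sum]
  simpa only [MulChar.ringHomComp_apply, eq_intCast] using hsum

/-- Since `χ` is real, the Jacobi sum of `ψ⁻¹` is the conjugate of that of `ψ`. For `A + B ω`, the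
norm is `A² - A B + B²`, the trace is `2 A - B`, and four times the norm is `(2 A - B)² + 3 B²`. -/
theorem four_mul_card_eq (hF : ringChar F ≠ 2) (h3 : ψ ^ 3 = 1) (hψ : ψ ≠ 1) :
    ∃ B : ℤ, 4 * (Fintype.card F : ℤ) = (3 * cubicQuadraticSum ψ + 1) ^ 2 + 3 * B ^ 2 := by
  set χ : MulChar F ℂ := (quadraticChar F).ringHomComp (Int.castRingHom ℂ) with hχdef
  have hχ2 : χ ^ 2 = 1 :=
    ((quadraticChar_isQuadratic F).comp (Int.castRingHom ℂ)).sq_eq_one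
  have hχ1 : χ ≠ 1 :=
    MulChar.ringHomComp_ne_one_iff Int.cast_injective |>.mpr (quadraticChar_ne_one hF)
  have hχinv : χ⁻¹ = χ := inv_eq_of_mul_eq_one_right (by rw [← sq, hχ2])
  have hψχ : ψ * χ ≠ 1 := by
    intro h
    have : (ψ * χ) ^ 2 = 1 := by rw [h, one_pow]
    rw [mul_pow, hχ2, mul_one] at this
    exact hψ (by simpa [pow_succ, this] using h3)
  have hω : IsPrimitiveRoot (Complex.exp (2 * Real.pi * Complex.I / (3 : ℕ))) 3 :=
    Complex.isPrimitiveRoot_exp 3 (by norm_num)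
  set ω := Complex.exp (2 * Real.pi * Complex.I / (3 : ℕ))
  have hω2 : ω ^ 2 = -1 - ω := by
    have := hω.geom_sum_eq_zero (by norm_num)
    simp only [Finset.sum_range_succ, Finset.sum_range_zero] at this
    linear_combination this
  have hωs : star ω = -1 - ω := by
    have h1 : star ω * ω = 1 := by
      have := Complex.normSq_eq_conj_mul_self (z := ω)
      rw [Complex.normSq_eq_norm_sq, hω.norm'_eq_one (by norm_num)] at this
      simpa using this.symm
    refine mul_right_cancel₀ (hω.ne_zero (by norm_num)) (h1.trans ?_)
    linear_combination hω2
  obtain ⟨A, B, hJ⟩ := exists_int_jacobiSum_quadraticChar h3 hω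
  have hJ' : jacobiSum ψ⁻¹ χ = A + B * (-1 - ω) := by
    rw [← hωs]
    have : jacobiSum ψ⁻¹ χ = star (jacobiSum ψ χ) := by
      rw [jacobiSum, jacobiSum, star_sum]
      refine Finset.sum_congr rfl fun u _ => ?_
      rw [star_mul', MulChar.star_apply', MulChar.star_apply', hχinv]
    rw [this, hJ]
    simp
  have hsum := jacobiSum_add_inv_quadraticChar hF h3
  have hmul : jacobiSum ψ χ * jacobiSum ψ⁻¹ χ⁻¹ = Fintype.card F :=
    jacobiSum_mul_jacobiSum_inv (by
      rw [ringChar.eq_zero]; exact (CharP.ringChar_ne_zero_of_finite F).symm) hψ hχ1 hψχ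
  rw [hχinv, hJ, hJ'] at hmul
  rw [← hχdef, hJ, hJ'] at hsum
  refine ⟨B, ?_⟩
  have e1 : 2 * A - B = 3 * cubicQuadraticSum ψ + 1 := by
    have : (2 * A - B : ℂ) = 3 * cubicQuadraticSum ψ + 1 := by rw [← hsum]; ring
    exact_mod_cast this
  have e2 : A ^ 2 - A * B + B ^ 2 = (Fintype.card F : ℤ) := by
    have : (A ^ 2 - A * B + B ^ 2 : ℂ) = Fintype.card F := by
      rw [← hmul]; linear_combination (B : ℂ) ^ 2 * hω2
    exact_mod_cast this
  rw [← e1, ← e2]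
  ring

theorem three_mul_card_filter_apply_eq_one (h3 : ψ ^ 3 = 1) (hψ : ψ ≠ 1) :
    3 * (Finset.univ.filter fun u : F => ψ u = 1).card + 1 = Fintype.card F := by
  have h0 : ∑ u : F, ψ u = 0 := MulChar.sum_eq_zero_of_ne_one hψ
  have h0' : ∑ u : F, ψ⁻¹ u = 0 := MulChar.sum_eq_zero_of_ne_one (inv_ne_one.mpr hψ)
  have : (3 * (Finset.univ.filter fun u : F => ψ u = 1).card + 1 : ℂ) = Fintype.card F := by
    have h1 : ∑ u : F, (if u = 0 then (1 : ℂ) else 0) = 1 := by simp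
    have key : ∀ u : F, 3 * (if ψ u = 1 then (1 : ℂ) else 0) + (if u = 0 then (1 : ℂ) else 0) =
        1 + ψ u + ψ⁻¹ u := by
      intro u
      by_cases hu : u = 0
      · simp [hu, MulChar.map_zero]
      · rcases MulChar.apply_eq_one_or_add_inv_apply h3 hu with ⟨h, h'⟩ | ⟨h, h'⟩
        · simp only [h, h', hu, if_true, if_false]; ring
        · simp only [h, hu, if_false]
          linear_combination -h'
    have hsum := Finset.sum_congr (rfl : (Finset.univ : Finset F) = _) fun u _ => key u
    rw [Finset.sum_add_distrib, Finset.sum_add_distrib, Finset.sum_add_distrib, h0, h0', h1,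
      ← Finset.mul_sum, ← Finset.sum_filter] at hsum
    simpa using hsum
  exact_mod_cast this

/-- The term `u = 1` vanishes, leaving an odd number of terms `± 1`. -/
theorem cubicQuadraticSum_odd
    (heven : Even (Finset.univ.filter fun u : F => ψ u = 1).card) :
    Odd (cubicQuadraticSum ψ) := by
  set S := Finset.univ.filter fun u : F => ψ u = 1 with hS
  have h1 : (1 : F) ∈ S := by simp [hS]
  have hsplit : cubicQuadraticSum ψ = ∑ u ∈ S.erase 1, quadraticChar F (1 - u) := by
    rw [cubicQuadraticSum, ← hS, ← Finset.add_sum_erase _ _ h1]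
    simp
  have hdvd : (2 : ℤ) ∣ ∑ u ∈ S.erase 1, (quadraticChar F (1 - u) - 1) := by
    refine Finset.dvd_sum fun u hu => ?_
    have : 1 - u ≠ 0 := sub_ne_zero.mpr (Finset.ne_of_mem_erase hu).symm
    rcases quadraticChar_dichotomy this with h | h <;> rw [h] <;> decide
  have hpos := Finset.card_pos.mpr ⟨1, h1⟩
  rw [Finset.sum_sub_distrib, ← hsplit, Finset.sum_const, nsmul_one,
    Finset.card_erase_of_mem h1] at hdvd
  obtain ⟨c, hc⟩ := heven
  rw [Int.odd_iff]
  omega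

theorem cubicQuadraticSum_eq_neg_one {n : ℕ} (hcard : Fintype.card F = 12 * n ^ 2 + 1)
    (hp : (12 * n ^ 2 + 1).Prime) (hF : ringChar F ≠ 2) (h3 : ψ ^ 3 = 1) (hψ : ψ ≠ 1) :
    cubicQuadraticSum ψ = -1 := by
  have hc := three_mul_card_filter_apply_eq_one h3 hψ
  obtain ⟨k, hk⟩ := cubicQuadraticSum_odd (ψ := ψ) ⟨2 * n ^ 2, by omega⟩
  obtain ⟨B, hB⟩ := four_mul_card_eq hF h3 hψ
  rw [hcard, hk] at hB
  push_cast at hB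
  obtain ⟨b, rfl | rfl⟩ := Int.even_or_odd' B
  · have := sq_eq_one_of_sq_add_three_mul_sq hp (x := 3 * k + 2) (y := b) (m := 2 * n)
      (by push_cast; linarith) (by push_cast; ring)
    rcases eq_or_eq_neg_of_sq_eq_sq _ 1 (this.trans (one_pow 2).symm) with h | h <;> omega
  -- For odd `B` the two sides of `hB` have different parity.
  · ring_nf at hB
    omega

end CubicCharacter

/-! ### Pairs of squares in different cubic classes -/

section CubicCharacter

variable {F : Type*} [Field F] [Fintype F] [DecidableEq F] {ψ : MulChar F ℂ}

/-- Put `r = (y + d) / y`, so `d = y (r - 1)`: then `y` is a square iff `χ (r - 1) = χ d`, and the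
conditions on `y + d = y r` become conditions on `r`. -/
theorem card_filter_quadraticChar_eq (ψ : MulChar F ℂ) {d : F} (hd : d ≠ 0) :
    (Finset.univ.filter fun y : F =>
      quadraticChar F y = 1 ∧ quadraticChar F (y + d) = 1 ∧ ψ y ≠ ψ (y + d)).card =
    (Finset.univ.filter fun r : F =>
      (quadraticChar F r = 1 ∧ ψ r ≠ 1) ∧ quadraticChar F (r - 1) = quadraticChar F d).card := by
  have hd' : quadraticChar F d ≠ 0 := fun h => hd (quadraticChar_eq_zero_iff.mp h)
  have hne : ∀ y : F, quadraticChar F y = 1 → y ≠ 0 := by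
    rintro y hy rfl
    simp at hy
  have hne' : ∀ r : F, ψ r ≠ 1 → r - 1 ≠ 0 := by
    intro r hr h
    rw [sub_eq_zero.mp h] at hr
    simp at hr
  refine Finset.card_nbij' (fun y => (y + d) / y) (fun r => d / (r - 1)) ?_ ?_ ?_ ?_
  · intro y hy
    simp only [Finset.coe_filter, Finset.mem_univ, true_and, Set.mem_ofPred_eq] at hy ⊢
    obtain ⟨h1, h2, h3⟩ := hy
    have hy0 := hne y h1
    have e1 : y + d = y * ((y + d) / y) := by field_simp
    have e2 : d = y * ((y + d) / y - 1) := by field_simp; ring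
    refine ⟨⟨?_, ?_⟩, ?_⟩
    · rw [e1, map_mul, h1, one_mul] at h2
      exact h2
    · intro h
      rw [e1, map_mul, h, mul_one] at h3
      exact h3 rfl
    · conv_rhs => rw [e2, map_mul, h1, one_mul]
  · intro r hr
    simp only [Finset.coe_filter, Finset.mem_univ, true_and, Set.mem_ofPred_eq] at hr ⊢
    obtain ⟨⟨h1, h2⟩, h3⟩ := hr
    have hr0 := hne' r h2
    have e1 : d / (r - 1) + d = d / (r - 1) * r := by field_simp; ring
    have e2 : d / (r - 1) * (r - 1) = d := by field_simp
    have h4 : quadraticChar F (d / (r - 1)) = 1 := by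
      have := congrArg (quadraticChar F) e2
      rw [map_mul, h3] at this
      exact mul_right_cancel₀ hd' (this.trans (one_mul _).symm)
    refine ⟨h4, ?_, ?_⟩
    · rw [e1, map_mul, h4, h1, one_mul]
    · rw [e1, map_mul]
      intro h
      have h5 : ψ (d / (r - 1)) ≠ 0 := by
        have := (div_ne_zero hd hr0).isUnit.map ψ
        exact this.ne_zero
      exact h2 (mul_left_cancel₀ h5 (h.symm.trans (mul_one _).symm))
  · intro y hy
    simp only [Finset.coe_filter, Finset.mem_univ, true_and, Set.mem_ofPred_eq] at hy
    have hy0 := hne y hy.1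
    have : (y + d) / y - 1 = d / y := by field_simp; ring
    simp only [this]
    field_simp
  · intro r hr
    simp only [Finset.coe_filter, Finset.mem_univ, true_and, Set.mem_ofPred_eq] at hr
    have hr0 := hne' r hr.1.2
    field_simp
    ring

/-- Twice the indicator of squares is `1 + χ r` for `r ≠ 0`, so the sum splits into two sums over
all nonzero noncubes. The first vanishes because `N = -1` cancels the term at zero; inversion
carries the second to the first. -/
theorem sum_quadraticChar_sub_one_eq_zero (hF : ringChar F ≠ 2) (hneg : quadraticChar F (-1) = 1)
    (hN : cubicQuadraticSum ψ = -1) :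
    ∑ r : F with quadraticChar F r = 1 ∧ ψ r ≠ 1, quadraticChar F (r - 1) = 0 := by
  have hsub : ∀ r : F, quadraticChar F (r - 1) = quadraticChar F (1 - r) := by
    intro r
    rw [← neg_sub, ← neg_one_mul, map_mul, hneg, one_mul]
  have hS : ∑ r : F with r ≠ 0 ∧ ψ r ≠ 1, quadraticChar F (1 - r) = 0 := by
    have h1 := Finset.sum_filter_add_sum_filter_not Finset.univ (fun u : F => ψ u = 1)
      (fun u => quadraticChar F (1 - u))
    have h2 : (Finset.univ.filter fun u : F => ¬ ψ u = 1) =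
        insert 0 (Finset.univ.filter fun u : F => u ≠ 0 ∧ ψ u ≠ 1) := by
      ext u
      by_cases hu : u = 0
      · simp [hu, MulChar.map_zero]
      · simp [hu]
    rw [sum_quadraticChar_one_sub hF, h2, Finset.sum_insert (by simp)] at h1
    have h3 : cubicQuadraticSum ψ = ∑ u with ψ u = 1, quadraticChar F (1 - u) := rfl
    rw [← h3, hN] at h1
    simpa using h1
  have hS' : ∑ r : F with r ≠ 0 ∧ ψ r ≠ 1, quadraticChar F r * quadraticChar F (r - 1) = 0 := by
    have hmaps : ∀ r ∈ Finset.univ.filter fun r : F => r ≠ 0 ∧ ψ r ≠ 1,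
        r⁻¹ ∈ Finset.univ.filter fun r : F => r ≠ 0 ∧ ψ r ≠ 1 := by
      intro r hr
      obtain ⟨hr0, hr1⟩ := (Finset.mem_filter.mp hr).2
      refine Finset.mem_filter.mpr ⟨Finset.mem_univ _, inv_ne_zero hr0, fun h => hr1 ?_⟩
      rw [← mul_one (ψ r), ← h, ← map_mul, mul_inv_cancel₀ hr0, map_one, h]
    rw [← hS]
    refine Finset.sum_nbij' (fun r => r⁻¹) (fun r => r⁻¹) ?_ ?_ ?_ ?_ ?_
    · exact hmaps
    · exact hmaps
    · intro r _; simp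
    · intro r _; simp
    · intro r hr
      have hr0 : r ≠ 0 := (Finset.mem_filter.mp hr).2.1
      rw [← map_mul, show r * (r - 1) = r ^ 2 * (1 - r⁻¹) by field_simp, map_mul,
        quadraticChar_sq_one' hr0, one_mul]
  have h2 : 2 * ∑ r : F with quadraticChar F r = 1 ∧ ψ r ≠ 1, quadraticChar F (r - 1) =
      ∑ r : F with r ≠ 0 ∧ ψ r ≠ 1, (quadraticChar F (1 - r) +
        quadraticChar F r * quadraticChar F (r - 1)) := by
    rw [Finset.sum_filter, Finset.sum_filter, Finset.mul_sum]
    refine Finset.sum_congr rfl fun r _ => ?_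
    by_cases hr : r = 0
    · simp [hr]
    · by_cases hψ : ψ r = 1
      · simp [hψ]
      · rcases quadraticChar_dichotomy hr with h | h
        · simp only [h, hr, hψ, hsub, ne_eq, not_false_eq_true, and_self, if_true]; ring
        · simp [h, hr, hψ, hsub]
  rw [Finset.sum_add_distrib, hS, hS'] at h2
  omega

/-- The condition `χ (r - 1) = χ d` has indicator `(1 + χ d χ (r - 1)) / 2`, whose second part sums
to zero. -/
theorem two_mul_card_filter_quadraticChar (hF : ringChar F ≠ 2) (hneg : quadraticChar F (-1) = 1)
    (hN : cubicQuadraticSum ψ = -1) {d : F} (hd : d ≠ 0) :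
    2 * (Finset.univ.filter fun y : F =>
      quadraticChar F y = 1 ∧ quadraticChar F (y + d) = 1 ∧ ψ y ≠ ψ (y + d)).card =
    (Finset.univ.filter fun r : F => quadraticChar F r = 1 ∧ ψ r ≠ 1).card := by
  rw [card_filter_quadraticChar_eq ψ hd, ← Finset.filter_filter]
  set S := Finset.univ.filter fun r : F => quadraticChar F r = 1 ∧ ψ r ≠ 1 with hS
  have h : (2 * (S.filter fun r => quadraticChar F (r - 1) = quadraticChar F d).card : ℤ) =
      ∑ r ∈ S, (1 + quadraticChar F d * quadraticChar F (r - 1)) := by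
    rw [Finset.card_filter]
    push_cast
    rw [Finset.mul_sum]
    refine Finset.sum_congr rfl fun r hr => ?_
    have hr1 : r - 1 ≠ 0 := by
      intro h
      rw [hS, Finset.mem_filter, sub_eq_zero.mp h] at hr
      simp at hr
    rcases quadraticChar_dichotomy hd with h | h <;>
      rcases quadraticChar_dichotomy hr1 with h' | h' <;> simp [h, h']
  rw [Finset.sum_add_distrib, ← Finset.mul_sum, hS, sum_quadraticChar_sub_one_eq_zero hF hneg hN,
    mul_zero, add_zero, ← hS] at h
  simpa using (by exact_mod_cast h : _ = (∑ r ∈ S, (1 : ℕ)))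

end CubicCharacter

/-! ### Difference systems, Levenshtein's bound and marker codes -/

section DifferenceSystem

variable {v q : ℕ} [NeZero v]

theorem count_outerDifferences (Q : Fin q → Finset (ZMod v)) (d : ZMod v) :
    (outerDifferences Q).count d = ∑ ij ∈ (Finset.univ : Finset (Fin q)).offDiag,
      (Finset.univ.filter fun y => y + d ∈ Q ij.1 ∧ y ∈ Q ij.2).card := by
  rw [outerDifferences, Multiset.count_sum']
  refine Finset.sum_congr rfl fun ij _ => ?_
  rw [Multiset.count_map, ← Finset.filter_val, Finset.card_val]
  refine Finset.card_nbij' (fun ab => ab.2) (fun y => (y + d, y)) ?_ ?_ ?_ ?_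
  · rintro ⟨a, b⟩ h
    simp only [Finset.coe_filter, Finset.mem_product, Set.mem_ofPred_eq] at h
    obtain ⟨⟨ha, hb⟩, rfl⟩ := h
    simpa using ⟨ha, hb⟩
  · intro y h
    simpa using h
  · rintro ⟨a, b⟩ h
    simp only [Finset.coe_filter, Finset.mem_product, Set.mem_ofPred_eq] at h
    obtain ⟨_, rfl⟩ := h
    simp
  · intro y _
    rfl

theorem count_outerDifferences_of_disjoint {Q : Fin q → Finset (ZMod v)}
    (hQ : ∀ i j, i ≠ j → Disjoint (Q i) (Q j)) (d : ZMod v) :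
    (outerDifferences Q).count d =
      (Finset.univ.filter fun y => ∃ i j, i ≠ j ∧ y + d ∈ Q i ∧ y ∈ Q j).card := by
  have huniq : ∀ i j x, x ∈ Q i → x ∈ Q j → i = j := fun i j x hi hj => by
    by_contra h
    exact Finset.disjoint_left.mp (hQ i j h) hi hj
  rw [count_outerDifferences, ← Finset.card_biUnion]
  · congr 1
    ext y
    simp
  · rintro ⟨i, j⟩ _ ⟨i', j'⟩ _ hne
    refine Finset.disjoint_left.mpr fun y h h' => hne ?_
    simp only [Finset.mem_filter, Finset.mem_univ, true_and] at h h'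
    rw [huniq _ _ _ h.1 h'.1, huniq _ _ _ h.2 h'.2]

theorem dssRedundancy_eq_sum {v q : ℕ} {Q : Fin q → Finset (ZMod v)}
    (hQ : ∀ i j, i ≠ j → Disjoint (Q i) (Q j)) : dssRedundancy Q = ∑ i, (Q i).card :=
  Finset.card_biUnion fun i _ j _ h => hQ i j h

/-- Levenshtein's bound for the redundancy of a difference system of sets. -/
theorem IsDSS.mul_add_sq_le {Q : Fin q → Finset (ZMod v)} {ρ : ℕ} (hQ : IsDSS Q ρ) :
    q * (ρ * (v - 1)) + dssRedundancy Q ^ 2 ≤ q * dssRedundancy Q ^ 2 := by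
  have hcard : (outerDifferences Q).card =
      ∑ ij ∈ (Finset.univ : Finset (Fin q)).offDiag, (Q ij.1).card * (Q ij.2).card := by
    rw [outerDifferences, Multiset.card_sum]
    simp
  have hle : ρ * (v - 1) ≤ (outerDifferences Q).card := by
    rw [← Multiset.sum_count_eq_card (s := Finset.univ) (fun a _ => Finset.mem_univ a),
      ← Finset.sum_erase_add _ _ (Finset.mem_univ 0)]
    refine le_trans ?_ (Nat.le_add_right _ _)
    have : (v - 1) = ((Finset.univ : Finset (ZMod v)).erase 0).card := by
      rw [Finset.card_erase_of_mem (Finset.mem_univ _), Finset.card_univ, ZMod.card]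
    rw [this, mul_comm, ← smul_eq_mul]
    exact Finset.card_nsmul_le_sum _ _ _ fun d hd => hQ.le_count d (Finset.ne_of_mem_erase hd)
  -- Outer differences are all pairs from the union minus the inner pairs; Cauchy–Schwarz then
  -- bounds the inner pairs below.
  have hsq : (outerDifferences Q).card + ∑ i, (Q i).card ^ 2 = dssRedundancy Q ^ 2 := by
    rw [dssRedundancy_eq_sum hQ.disjoint, hcard, sq (∑ i, _), Finset.sum_mul_sum,
      ← Finset.sum_product', ← Finset.diag_union_offDiag,
      Finset.sum_union (Finset.disjoint_diag_offDiag _), Finset.sum_diag, add_comm]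
    simp only [sq]
  have hcs : dssRedundancy Q ^ 2 ≤ q * ∑ i, (Q i).card ^ 2 := by
    rw [dssRedundancy_eq_sum hQ.disjoint]
    simpa using sq_sum_le_card_mul_sum_sq (s := Finset.univ) (f := fun i => (Q i).card)
  rw [← hsq, mul_add, hsq]
  exact add_le_add (Nat.mul_le_mul_left _ hle) hcs

theorem natCast_fin_injective (v : ℕ) [NeZero v] :
    Function.Injective fun k : Fin v => ((k : ℕ) : ZMod v) := by
  intro a b h
  have := (ZMod.natCast_eq_natCast_iff' _ _ _).mp h
  rw [Nat.mod_eq_of_lt a.isLt, Nat.mod_eq_of_lt b.isLt] at this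
  exact Fin.ext this

theorem card_freePosition (Q : Fin q → Finset (ZMod v)) :
    Nat.card (FreePosition Q) = v - dssRedundancy Q := by
  have hbij : Function.Bijective fun k : Fin v => ((k : ℕ) : ZMod v) :=
    (Fintype.bijective_iff_injective_and_card _).mpr ⟨natCast_fin_injective v, by simp⟩
  have e : FreePosition Q ≃ {x : ZMod v // x ∈ (Finset.univ.biUnion Q)ᶜ} :=
    (Equiv.ofBijective _ hbij).subtypeEquiv fun k => by simp
  rw [Nat.card_congr e, Nat.card_eq_fintype_card, Fintype.card_coe, Finset.card_compl, ZMod.card,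
    dssRedundancy]

/-- The word that carries the symbol `i` in the positions of `Q i`, and `0` elsewhere. -/
def markerWord {v q : ℕ} (Q : Fin q → Finset (ZMod v)) : Fin v → ZMod q := fun k =>
  ∑ i, if ((k : ℕ) : ZMod v) ∈ Q i then ((i : ℕ) : ZMod q) else 0

/-- Exhibits the code as a translate of an injective linear image of the payload, which yields both
its size and its coset structure. -/
theorem markerCode_eq_image {v q : ℕ} {Q : Fin q → Finset (ZMod v)}
    (hQ : ∀ i j, i ≠ j → Disjoint (Q i) (Q j)) (D : Set (FreePosition Q → ZMod q)) :
    markerCode Q D = (fun u => markerWord Q +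
      Function.ExtendByZero.linearMap (ZMod q) (Subtype.val : FreePosition Q → Fin v) u) '' D := by
  have hmem : ∀ (i : Fin q) (k : Fin v), ((k : ℕ) : ZMod v) ∈ Q i →
      markerWord Q k = ((i : ℕ) : ZMod q) := by
    intro i k hk
    rw [markerWord, Finset.sum_eq_single i, if_pos hk]
    · intro j _ hj
      exact if_neg (Finset.disjoint_left.mp (hQ i j hj.symm) hk)
    · simp
  have hfree : ∀ k : FreePosition Q, markerWord Q k.1 = 0 := by
    intro k
    exact Finset.sum_eq_zero fun i _ => if_neg (k.2 i)
  have hext : ∀ (u : FreePosition Q → ZMod q) (k : FreePosition Q),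
      Function.ExtendByZero.linearMap (ZMod q) (Subtype.val : FreePosition Q → Fin v) u k.1 = u k :=
    fun u k => Subtype.val_injective.extend_apply u (0 : Fin v → ZMod q) k
  have hext' : ∀ (u : FreePosition Q → ZMod q) (i : Fin q) (k : Fin v), ((k : ℕ) : ZMod v) ∈ Q i →
      Function.ExtendByZero.linearMap (ZMod q) (Subtype.val : FreePosition Q → Fin v) u k = 0 := by
    intro u i k hk
    refine Function.extend_apply' u (0 : Fin v → ZMod q) k ?_
    rintro ⟨a, rfl⟩
    exact a.2 i hk
  ext w
  constructor
  · rintro ⟨hw, hD⟩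
    refine ⟨_, hD, ?_⟩
    ext k
    simp only [Pi.add_apply]
    by_cases hk : ∃ i, ((k : ℕ) : ZMod v) ∈ Q i
    · obtain ⟨i, hi⟩ := hk
      rw [hmem i k hi, hext' _ i k hi, hw i k hi, add_zero]
    · have hk' := not_exists.mp hk
      have h1 := hfree ⟨k, hk'⟩
      have h2 := hext (fun k => w k.1) ⟨k, hk'⟩
      rw [h1, h2, zero_add]
  · rintro ⟨u, hu, rfl⟩
    refine ⟨fun i k hk => ?_, ?_⟩
    · simp only [Pi.add_apply]
      rw [hmem i k hk, hext' u i k hk, add_zero]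
    · have : (fun k : FreePosition Q => (markerWord Q +
          Function.ExtendByZero.linearMap (ZMod q) (Subtype.val : FreePosition Q → Fin v) u) k.1)
          = u := by
        ext k
        rw [Pi.add_apply, hfree, hext, zero_add]
      rw [this]
      exact hu

theorem extendByZero_freePosition_injective {v q : ℕ} (Q : Fin q → Finset (ZMod v)) :
    Function.Injective
      (Function.ExtendByZero.linearMap (ZMod q) (Subtype.val : FreePosition Q → Fin v)) :=
  fun _ _ h => Function.extend_injective Subtype.val_injective (0 : Fin v → ZMod q) h

theorem ncard_markerCode_univ {Q : Fin q → Finset (ZMod v)}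
    (hQ : ∀ i j, i ≠ j → Disjoint (Q i) (Q j)) :
    (markerCode Q Set.univ).ncard = q ^ (v - dssRedundancy Q) := by
  have hinj := (add_right_injective (markerWord Q)).comp (extendByZero_freePosition_injective Q)
  rw [markerCode_eq_image hQ]
  refine (Set.ncard_image_of_injective _ hinj).trans ?_
  rw [Set.ncard_univ,
    Nat.card_fun, Nat.card_zmod, card_freePosition]

theorem exists_markerCode_eq_coset {v q : ℕ} {Q : Fin q → Finset (ZMod v)}
    (hQ : ∀ i j, i ≠ j → Disjoint (Q i) (Q j)) (D : Submodule (ZMod q) (FreePosition Q → ZMod q)) :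
    ∃ (c : Fin v → ZMod q) (L : Submodule (ZMod q) (Fin v → ZMod q)),
      Module.finrank (ZMod q) L = Module.finrank (ZMod q) D ∧
      markerCode Q (D : Set (FreePosition Q → ZMod q)) =
        (fun l => c + l) '' (L : Set (Fin v → ZMod q)) := by
  refine ⟨markerWord Q, D.map (Function.ExtendByZero.linearMap (ZMod q) Subtype.val),
    (D.equivMapOfInjective _ (extendByZero_freePosition_injective Q)).finrank_eq.symm, ?_⟩
  rw [markerCode_eq_image hQ, Submodule.map_coe, Set.image_image]

/-- If `u + i ∈ Q a` and `u ∈ Q b` with `a ≠ b`, then at position `u + i` the codeword shows `a`,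
while the splice shows the symbol `b` from position `u` of `x` or `y`. -/
theorem IsDSS.isCommaFree_markerCode {Q : Fin q → Finset (ZMod v)} {ρ : ℕ} (hQ : IsDSS Q ρ)
    (D : Set (FreePosition Q → ZMod q)) : IsCommaFree (markerCode Q D) ρ := by
  intro x hx y hy z hz i hi hiv
  have hsymb : ∀ a b : Fin q, a ≠ b → ((a : ℕ) : ZMod q) ≠ ((b : ℕ) : ZMod q) := by
    intro a b hab h
    have : NeZero q := ⟨by have := a.isLt; omega⟩
    exact hab (natCast_fin_injective q h)
  have hd : ((i : ℕ) : ZMod v) ≠ 0 := by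
    rw [Ne, ZMod.natCast_eq_zero_iff]
    exact Nat.not_dvd_of_pos_of_lt hi hiv
  refine (hQ.le_count _ hd).trans ?_
  rw [count_outerDifferences_of_disjoint hQ.disjoint, hammingDist]
  refine Finset.card_le_card_of_injOn (fun u => ⟨(u + i).val, ZMod.val_lt _⟩) ?_ ?_
  · intro u hu
    simp only [Finset.coe_filter, Finset.mem_univ, true_and, Set.mem_ofPred_eq] at hu ⊢
    obtain ⟨a, b, hab, ha, hb⟩ := hu
    have hk : (((u + i).val : ℕ) : ZMod v) = u + i := ZMod.natCast_zmod_val _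
    have hlt : (u + (i : ZMod v)).val < v := ZMod.val_lt _
    rw [hz.1 a _ (by simpa only [hk] using ha)]
    have hs : splice x y i ⟨(u + i).val, hlt⟩ = ((b : ℕ) : ZMod q) := by
      unfold splice
      split_ifs with h
      · refine hx.1 b _ ?_
        have : ((v - i + (u + (i : ZMod v)).val : ℕ) : ZMod v) = u := by
          rw [Nat.cast_add, Nat.cast_sub hiv.le, hk]
          simp
        simpa only [this] using hb
      · refine hy.1 b _ ?_
        have : (((u + (i : ZMod v)).val - i : ℕ) : ZMod v) = u := by
          rw [Nat.cast_sub (not_lt.mp h), hk]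
          simp
        simpa only [this] using hb
    rw [hs]
    exact hsymb a b hab
  · intro u _ u' _ h
    exact add_right_cancel (ZMod.val_injective v (Fin.ext_iff.mp h))

end DifferenceSystem

/-! ### Cyclotomic classes of order six -/

section CyclotomicClasses

variable {n : ℕ}

theorem mem_cyclotomicClass_six_iff {α : (ZMod (12 * n ^ 2 + 1))ˣ} (hord : orderOf α = 12 * n ^ 2)
    (hn : n ≠ 0) {i : ℕ} (hi : i < 6) (k : ℕ) :
    ((α ^ k : (ZMod (12 * n ^ 2 + 1))ˣ) : ZMod (12 * n ^ 2 + 1)) ∈ cyclotomicClass α 6 i ↔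
      k % 6 = i := by
  have hm : (12 * n ^ 2 + 1 - 1) / 6 = 2 * n ^ 2 := by omega
  have hn2 : 0 < n ^ 2 := by positivity
  simp only [cyclotomicClass, hm, Finset.mem_image, Finset.mem_range, Units.val_inj]
  constructor
  · rintro ⟨t, -, h⟩
    rw [pow_eq_pow_iff_modEq, hord] at h
    have h6 : i + t * 6 ≡ k [MOD 6] := h.of_dvd ⟨2 * n ^ 2, by ring⟩
    unfold Nat.ModEq at h6
    omega
  · intro h
    have hlt := Nat.mod_lt k (show 0 < 12 * n ^ 2 by omega)
    have h6 : k % (12 * n ^ 2) % 6 = k % 6 := Nat.mod_mod_of_dvd _ ⟨2 * n ^ 2, by ring⟩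
    refine ⟨k % (12 * n ^ 2) / 6, by omega, ?_⟩
    rw [pow_eq_pow_iff_modEq, hord, show i + k % (12 * n ^ 2) / 6 * 6 = k % (12 * n ^ 2) by omega]
    exact Nat.mod_modEq _ _

theorem card_cyclotomicClass_six {α : (ZMod (12 * n ^ 2 + 1))ˣ} (hord : orderOf α = 12 * n ^ 2)
    {i : ℕ} (hi : i < 6) : (cyclotomicClass α 6 i).card = 2 * n ^ 2 := by
  have hm : (12 * n ^ 2 + 1 - 1) / 6 = 2 * n ^ 2 := by omega
  rw [cyclotomicClass, hm, Finset.card_image_of_injOn, Finset.card_range]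
  intro s hs t ht h
  simp only [Finset.coe_range, Set.mem_Iio] at hs ht
  have := pow_injOn_Iio_orderOf (x := α) (by rw [hord, Set.mem_Iio]; omega)
    (by rw [hord, Set.mem_Iio]; omega) (Units.val_injective h)
  omega

theorem exists_pow_eq_of_forall_mem_zpowers {p : ℕ} [Fact p.Prime] {α : (ZMod p)ˣ}
    (hα : ∀ x, x ∈ Subgroup.zpowers α) {x : ZMod p} (hx : x ≠ 0) :
    ∃ k : ℕ, x = ((α ^ k : (ZMod p)ˣ) : ZMod p) := by
  obtain ⟨k, hk⟩ := mem_powers_iff_mem_zpowers.mpr (hα (Units.mk0 x hx))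
  exact ⟨k, by simpa using (congrArg Units.val hk).symm⟩

theorem quadraticChar_apply_primitive {p : ℕ} [Fact p.Prime] (hp : p ≠ 2) {α : (ZMod p)ˣ}
    (hα : ∀ x, x ∈ Subgroup.zpowers α) : quadraticChar (ZMod p) α = -1 := by
  refine (quadraticChar_dichotomy α.ne_zero).resolve_left fun h => ?_
  refine quadraticChar_ne_one (F := ZMod p) (by rwa [ZMod.ringChar_zmod_n]) ?_
  rw [MulChar.eq_iff hα, h, MulChar.one_apply_coe]

theorem isPrimitiveRoot_apply_primitive {p : ℕ} [Fact p.Prime] {α : (ZMod p)ˣ}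
    (hα : ∀ x, x ∈ Subgroup.zpowers α) {ψ : MulChar (ZMod p) ℂ} (hψ : orderOf ψ = 3) :
    IsPrimitiveRoot (ψ α) 3 := by
  have : Fact (Nat.Prime 3) := ⟨Nat.prime_three⟩
  refine IsPrimitiveRoot.iff_orderOf.mpr (orderOf_eq_prime ?_ fun h => ?_)
  · rw [← MulChar.pow_apply' ψ (by norm_num), ← hψ, pow_orderOf_eq_one, MulChar.one_apply_coe]
  · have : ψ = 1 := by rw [MulChar.eq_iff hα, h, MulChar.one_apply_coe]
    rw [this, orderOf_one] at hψ
    norm_num at hψ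

/-- An exponent modulo `6` is determined by its parity, read by `χ`, and its residue modulo `3`,
read by `ψ`. -/
theorem mem_cyclotomicClass_six_iff_char [Fact (12 * n ^ 2 + 1).Prime]
    {α : (ZMod (12 * n ^ 2 + 1))ˣ} (hα : ∀ x, x ∈ Subgroup.zpowers α)
    (hord : orderOf α = 12 * n ^ 2) (hn : n ≠ 0) {ψ : MulChar (ZMod (12 * n ^ 2 + 1)) ℂ}
    (hψ : orderOf ψ = 3) {i : ℕ} (hi : i < 3) (x : ZMod (12 * n ^ 2 + 1)) :
    x ∈ cyclotomicClass α 6 (2 * i) ↔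
      quadraticChar (ZMod (12 * n ^ 2 + 1)) x = 1 ∧ ψ x = ψ α ^ (2 * i) := by
  by_cases hx : x = 0
  · subst hx
    simp only [cyclotomicClass, Finset.mem_image, MulChar.map_zero]
    exact ⟨fun ⟨t, _, h⟩ => absurd h (Units.ne_zero _), fun h => absurd h.1 (by norm_num)⟩
  · obtain ⟨k, rfl⟩ := exists_pow_eq_of_forall_mem_zpowers hα hx
    have hβ := isPrimitiveRoot_apply_primitive hα hψ
    have hp2 : 12 * n ^ 2 + 1 ≠ 2 := by omega
    rw [mem_cyclotomicClass_six_iff hord hn (by omega), Units.val_pow_eq_pow_val, map_pow, map_pow,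
      quadraticChar_apply_primitive hp2 hα, (hβ.isOfFinOrder (by norm_num)).pow_eq_pow_iff_modEq,
      ← hβ.eq_orderOf, neg_one_pow_eq_one_iff_even (by norm_num), Nat.even_iff, Nat.ModEq]
    omega

theorem isPerfectRegularDSS_cyclotomicClass (hp : (12 * n ^ 2 + 1).Prime)
    {α : (ZMod (12 * n ^ 2 + 1))ˣ} (hα : ∀ x, x ∈ Subgroup.zpowers α) :
    IsPerfectRegularDSS (12 * n ^ 2 + 1) (2 * n ^ 2) 3 (2 * n ^ 2)
      (fun i : Fin 3 => cyclotomicClass α 6 (2 * i)) := by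
  have : Fact (12 * n ^ 2 + 1).Prime := ⟨hp⟩
  have hn : n ≠ 0 := by
    rintro rfl
    exact hp.ne_one rfl
  have hord : orderOf α = 12 * n ^ 2 := by
    rw [orderOf_eq_card_of_forall_mem_zpowers hα, Nat.card_eq_fintype_card,
      ZMod.card_units_eq_totient, Nat.totient_prime hp, Nat.add_sub_cancel]
  have hF : ringChar (ZMod (12 * n ^ 2 + 1)) ≠ 2 := by
    rw [ZMod.ringChar_zmod_n]
    omega
  have hcard : Fintype.card (ZMod (12 * n ^ 2 + 1)) = 12 * n ^ 2 + 1 := ZMod.card _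
  obtain ⟨ψ, hψ⟩ := MulChar.exists_mulChar_orderOf (ZMod (12 * n ^ 2 + 1)) (n := 3)
    ⟨4 * n ^ 2, by rw [hcard]; omega⟩ (Complex.isPrimitiveRoot_exp 3 (by norm_num))
  have h3 : ψ ^ 3 = 1 := by rw [← hψ, pow_orderOf_eq_one]
  have hψ1 : ψ ≠ 1 := by
    rintro rfl
    rw [orderOf_one] at hψ
    norm_num at hψ
  have hβ := isPrimitiveRoot_apply_primitive hα hψ
  have hneg : quadraticChar (ZMod (12 * n ^ 2 + 1)) (-1) = 1 := by
    rw [quadraticChar_one_iff_isSquare (neg_ne_zero.mpr one_ne_zero),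
      FiniteField.isSquare_neg_one_iff, hcard]
    omega
  have hN := cubicQuadraticSum_eq_neg_one hcard hp hF h3 hψ1
  have hmem : ∀ (i : Fin 3) (x : ZMod (12 * n ^ 2 + 1)), x ∈ cyclotomicClass α 6 (2 * i) ↔
      quadraticChar (ZMod (12 * n ^ 2 + 1)) x = 1 ∧ ψ x = ψ α ^ (2 * (i : ℕ)) :=
    fun i x => mem_cyclotomicClass_six_iff_char hα hord hn hψ i.isLt x
  have hinj : ∀ i j : Fin 3, ψ α ^ (2 * (i : ℕ)) = ψ α ^ (2 * (j : ℕ)) → i = j := by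
    intro i j h
    rw [(hβ.isOfFinOrder (by norm_num)).pow_eq_pow_iff_modEq, ← hβ.eq_orderOf, Nat.ModEq] at h
    omega
  have hex : ∀ x : ZMod (12 * n ^ 2 + 1), quadraticChar (ZMod (12 * n ^ 2 + 1)) x = 1 →
      ∃ i : Fin 3, ψ x = ψ α ^ (2 * (i : ℕ)) := by
    intro x hx
    have hx0 : x ≠ 0 := by
      rintro rfl
      simp at hx
    obtain ⟨k, hk, h⟩ := MulChar.exists_apply_eq_pow h3 hβ hx0
    -- `2` is its own inverse modulo `3`.
    refine ⟨⟨2 * k % 3, Nat.mod_lt _ (by norm_num)⟩, ?_⟩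
    rw [h, (hβ.isOfFinOrder (by norm_num)).pow_eq_pow_iff_modEq, ← hβ.eq_orderOf, Nat.ModEq]
    simp only
    omega
  have hdisj : ∀ i j : Fin 3, i ≠ j →
      Disjoint (cyclotomicClass α 6 (2 * i)) (cyclotomicClass α 6 (2 * j)) := by
    refine fun i j hij => Finset.disjoint_left.mpr fun x hi hj => hij (hinj i j ?_)
    rw [← ((hmem i x).mp hi).2, ((hmem j x).mp hj).2]
  have hreg : ∀ i : Fin 3, (cyclotomicClass α 6 (2 * i)).card = 2 * n ^ 2 :=
    fun i => card_cyclotomicClass_six hord (by omega)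
  have hS : (Finset.univ.filter fun r : ZMod (12 * n ^ 2 + 1) =>
      quadraticChar (ZMod (12 * n ^ 2 + 1)) r = 1 ∧ ψ r ≠ 1).card = 4 * n ^ 2 := by
    have : (Finset.univ.filter fun r : ZMod (12 * n ^ 2 + 1) =>
        quadraticChar (ZMod (12 * n ^ 2 + 1)) r = 1 ∧ ψ r ≠ 1) =
        cyclotomicClass α 6 (2 * (1 : Fin 3)) ∪ cyclotomicClass α 6 (2 * (2 : Fin 3)) := by
      ext r
      rw [Finset.mem_union, hmem, hmem, Finset.mem_filter]
      constructor
      · rintro ⟨-, hr, hr1⟩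
        obtain ⟨i, hi⟩ := hex r hr
        fin_cases i
        · simp at hi
          exact absurd hi hr1
        · exact Or.inl ⟨hr, hi⟩
        · exact Or.inr ⟨hr, hi⟩
      · rintro (⟨hr, hi⟩ | ⟨hr, hi⟩) <;> refine ⟨Finset.mem_univ _, hr, fun h => ?_⟩
        · exact absurd (hinj 0 1 (by rw [← hi, h]; simp)) (by decide)
        · exact absurd (hinj 0 2 (by rw [← hi, h]; simp)) (by decide)
    rw [this, Finset.card_union_of_disjoint (hdisj 1 2 (by decide)), hreg, hreg]
    ring
  have hcount : ∀ d : ZMod (12 * n ^ 2 + 1), d ≠ 0 →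
      (outerDifferences fun i : Fin 3 => cyclotomicClass α 6 (2 * i)).count d = 2 * n ^ 2 := by
    intro d hd
    have h2 := two_mul_card_filter_quadraticChar hF hneg hN hd
    rw [hS] at h2
    rw [count_outerDifferences_of_disjoint hdisj]
    have : (Finset.univ.filter fun y : ZMod (12 * n ^ 2 + 1) => ∃ i j : Fin 3, i ≠ j ∧
        y + d ∈ cyclotomicClass α 6 (2 * i) ∧ y ∈ cyclotomicClass α 6 (2 * j)) =
        Finset.univ.filter fun y => quadraticChar (ZMod (12 * n ^ 2 + 1)) y = 1 ∧
          quadraticChar (ZMod (12 * n ^ 2 + 1)) (y + d) = 1 ∧ ψ y ≠ ψ (y + d) := by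
      ext y
      simp only [Finset.mem_filter, Finset.mem_univ, true_and, hmem]
      constructor
      · rintro ⟨i, j, hij, ⟨h1, h1'⟩, h2, h2'⟩
        refine ⟨h2, h1, fun h => hij (hinj i j ?_)⟩
        rw [← h1', ← h2', h]
      · rintro ⟨h1, h2, h⟩
        obtain ⟨j, hj⟩ := hex y h1
        obtain ⟨i, hi⟩ := hex (y + d) h2
        refine ⟨i, j, fun hij => h ?_, ⟨h2, hi⟩, h1, hj⟩
        rw [hi, hj, hij]
    rw [this]
    omega
  exact ⟨⟨hdisj, fun d hd => (hcount d hd).ge⟩, hreg, hcount⟩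

end CyclotomicClasses

/-! ### Optimality and conclusion -/

theorem IsDSS.six_mul_sq_le_dssRedundancy {n : ℕ} {P : Fin 3 → Finset (ZMod (12 * n ^ 2 + 1))}
    (hP : IsDSS P (2 * n ^ 2)) : 6 * n ^ 2 ≤ dssRedundancy P := by
  -- With redundancy `R` this reads `72 n⁴ ≤ 2 R²`, that is `(6 n²)² ≤ R²`.
  have h := hP.mul_add_sq_le
  rw [Nat.add_sub_cancel] at h
  by_contra! hlt
  nlinarith

theorem mainTheorem4 (n : ℕ) (hp : Nat.Prime (12 * n ^ 2 + 1)) :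
    (∃ Q : Fin 3 → Finset (ZMod (12 * n ^ 2 + 1)),
      IsPerfectRegularDSS (12 * n ^ 2 + 1) (2 * n ^ 2) 3 (2 * n ^ 2) Q) ∧
    ∀ α : (ZMod (12 * n ^ 2 + 1))ˣ, (∀ x, x ∈ Subgroup.zpowers α) →
      ∀ Q : Fin 3 → Finset (ZMod (12 * n ^ 2 + 1)),
        Q = ![cyclotomicClass α 6 0, cyclotomicClass α 6 2, cyclotomicClass α 6 4] →
        IsPerfectRegularDSS (12 * n ^ 2 + 1) (2 * n ^ 2) 3 (2 * n ^ 2) Q ∧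
        IsOptimalDSS Q (2 * n ^ 2) ∧
        dssRedundancy Q = 6 * n ^ 2 ∧
        (∀ D : Set (FreePosition Q → ZMod 3), IsCommaFree (markerCode Q D) (2 * n ^ 2)) ∧
        (∀ D : Submodule (ZMod 3) (FreePosition Q → ZMod 3),
          ∃ (c : Fin (12 * n ^ 2 + 1) → ZMod 3)
            (L : Submodule (ZMod 3) (Fin (12 * n ^ 2 + 1) → ZMod 3)),
            Module.finrank (ZMod 3) L = Module.finrank (ZMod 3) D ∧
            markerCode Q (D : Set (FreePosition Q → ZMod 3)) =
              (fun l => c + l) '' (L : Set (Fin (12 * n ^ 2 + 1) → ZMod 3))) ∧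
        (markerCode Q Set.univ).ncard = 3 ^ (6 * n ^ 2 + 1) ∧
        ∀ P : Fin 3 → Finset (ZMod (12 * n ^ 2 + 1)), IsDSS P (2 * n ^ 2) →
          (markerCode P Set.univ).ncard ≤ (markerCode Q Set.univ).ncard := by
  have : Fact (12 * n ^ 2 + 1).Prime := ⟨hp⟩
  have hmain : ∀ α : (ZMod (12 * n ^ 2 + 1))ˣ, (∀ x, x ∈ Subgroup.zpowers α) →
      IsPerfectRegularDSS (12 * n ^ 2 + 1) (2 * n ^ 2) 3 (2 * n ^ 2)
        ![cyclotomicClass α 6 0, cyclotomicClass α 6 2, cyclotomicClass α 6 4] := by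
    intro α hα
    convert isPerfectRegularDSS_cyclotomicClass hp hα using 1
    ext i : 1
    fin_cases i <;> rfl
  constructor
  · obtain ⟨α, hα⟩ := IsCyclic.exists_generator (α := (ZMod (12 * n ^ 2 + 1))ˣ)
    exact ⟨_, hmain α hα⟩
  · rintro α hα Q hQ
    have hDSS : IsPerfectRegularDSS (12 * n ^ 2 + 1) (2 * n ^ 2) 3 (2 * n ^ 2) Q :=
      hQ ▸ hmain α hα
    have hdisj := hDSS.isDSS.disjoint
    have hred : dssRedundancy Q = 6 * n ^ 2 := by
      rw [dssRedundancy_eq_sum hdisj, Finset.sum_congr rfl fun i _ => hDSS.regular i,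
        Finset.sum_const, Finset.card_univ, Fintype.card_fin, smul_eq_mul]
      ring
    refine ⟨hDSS, ⟨hDSS.isDSS, fun P hP => hred.trans_le hP.six_mul_sq_le_dssRedundancy⟩, hred,
      hDSS.isDSS.isCommaFree_markerCode, exists_markerCode_eq_coset hdisj, ?_, fun P hP => ?_⟩
    · rw [ncard_markerCode_univ hdisj, hred]
      congr 1
      omega
    · rw [ncard_markerCode_univ hdisj, ncard_markerCode_univ hP.disjoint, hred]
      exact Nat.pow_le_pow_right (by norm_num)
        (Nat.sub_le_sub_left hP.six_mul_sq_le_dssRedundancy _)
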